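/- For $k\ge 3$ let $\mathfrak{B}_k(n)$ denote the number of $k$ dots bracelet partitions of $n$, defined by the generating function $$\sum_{n=0}^{\infty}\mathfrak{B}_k(n)q^n=\frac{(-q;q)_\infty}{(q;q)_\infty^{k-1}\,(-q^k;q^k)_\infty},\qquad (a;q)_\infty=\prod_{j=0}^{\infty}(1-aq^j).$$ Let $p\ge 5$ be a prime with Legendre symbol $\left(\frac{-10}{p}\right)=-1$. Then for all integers $\alpha\ge 1$, $n\ge 0$ and $1\le i\le p-1$, the number $\frac{5(24i+7p)p^{2\alpha-1}+1}{3}$ is an integer and $$\mathfrak{B}_5\!\left(40\,p^{2\alpha}n+\frac{5(24i+7p)p^{2\alpha-1}+1}{3}\right)\equiv 0 \pmod 2.$$ -/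

import Mathlib

noncomputable section

namespace BraceletPartition

open PowerSeries
open scoped PowerSeries.WithPiTopology

/-- The infinite `q`-shifted factorial `(a; b)_∞ = ∏_{j ≥ 0} (1 - a * b ^ j)` for formal power
series `a`, `b` with integer coefficients. The product is taken in the topology of coefficientwise
convergence, `ℤ` being discrete. -/
def qPoch (a b : ℤ⟦X⟧) : ℤ⟦X⟧ :=
  ∏' j : ℕ, (1 - a * b ^ j)

/-- The product defining `(a; b)_∞` converges as soon as `b` has no constant term. -/
theorem multipliable_qPoch (a b : ℤ⟦X⟧) (hb : constantCoeff b = 0) :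
    Multipliable fun j : ℕ => 1 - a * b ^ j := by
  simp_rw [sub_eq_add_neg]
  apply PowerSeries.WithPiTopology.multipliable_one_add_of_tendsto_order_atTop_nhds_top
  have hb1 : (1 : ℕ∞) ≤ b.order := by
    rw [Order.one_le_iff_ne_zero]
    exact (PowerSeries.order_ne_zero_iff_constCoeff_eq_zero).2 hb
  refine ENat.tendsto_nhds_top_iff_natCast_lt.2 fun n => ?_
  filter_upwards [Filter.eventually_gt_atTop n] with j hj
  rw [PowerSeries.order_neg]
  refine lt_of_lt_of_le (b := (j : ℕ∞)) (by exact_mod_cast hj) ?_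
  calc (j : ℕ∞) = j • (1 : ℕ∞) := by simp
    _ ≤ j • b.order := nsmul_le_nsmul_right hb1 j
    _ ≤ (b ^ j).order := PowerSeries.le_order_pow b j
    _ ≤ a.order + (b ^ j).order := le_add_self
    _ ≤ (a * b ^ j).order := PowerSeries.le_order_mul _ _

theorem constantCoeff_qPoch (a b : ℤ⟦X⟧) (ha : constantCoeff a = 0) (hb : constantCoeff b = 0) :
    constantCoeff (qPoch a b) = 1 := by
  rw [qPoch, (multipliable_qPoch a b hb).map_tprod (constantCoeff (R := ℤ))
    (PowerSeries.WithPiTopology.continuous_constantCoeff ℤ)]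
  simp [ha]

/-- The denominator `(q; q)_∞ ^ (k - 1) * (-q ^ k; q ^ k)_∞`. -/
def denom (k : ℕ) : ℤ⟦X⟧ :=
  qPoch X X ^ (k - 1) * qPoch (-X ^ k) (X ^ k)

/-- The generating function
`∑ 𝔅_k(n) q ^ n = (-q; q)_∞ / ((q; q)_∞ ^ (k - 1) * (-q ^ k; q ^ k)_∞)` of the `k` dots bracelet
partitions (for `k ≥ 3`). The denominator has constant coefficient `1`, so it is
invertible in `ℤ⟦X⟧`. -/
def genFun (k : ℕ) : ℤ⟦X⟧ :=
  qPoch (-X) X * invOfUnit (denom k) 1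

/-- `𝔅_k(n)`, the number of `k` dots bracelet partitions of `n`, defined by its generating
function. -/
def bracelet (k n : ℕ) : ℤ :=
  coeff n (genFun k)

/-- The quotient in `genFun` is the true quotient. -/
theorem genFun_mul_denom (k : ℕ) (hk : 3 ≤ k) : genFun k * denom k = qPoch (-X) X := by
  have hk0 : k ≠ 0 := by omega
  have h : constantCoeff (denom k) = ((1 : ℤˣ) : ℤ) := by
    simp [denom, constantCoeff_qPoch, hk0]
  rw [genFun, mul_assoc, mul_comm (invOfUnit _ _), mul_invOfUnit _ _ h, mul_one]

end BraceletPartition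

end

/-! Modulo 2 signs vanish. With F = ∏(1 - q^n) and G = F(q^5), the generating function for k = 5
becomes 1/(F^3 G).

The engine is the modular equation F G = F^6 + q G^6 (`euler_mul_expand_five`). By Gauss, F^3 is the
triangular series ψ, so F^3 G^3 = ψ(q)ψ(q^5); counting representations by x^2 + 5y^2 modulo 2 gives
F^8 G^2 + q F^2 G^8.

Squares mod 2 are series in q^2, so this equation repeatedly splits off even and odd parts. Together
with the 5n+1 part of F, it shows that 𝔅_5(40m+12) is the coefficient of q^m in F(q^2)F(q^5).

By the pentagonal number theorem, a nonzero coefficient forces 24m + 7 = 2x^2 + 5y^2. For the m of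
the theorem, p divides 24m + 7 to an exact odd power, impossible when -10 is a nonresidue. -/

namespace BraceletPartition

open PowerSeries
open scoped PowerSeries.WithPiTopology
open Finset.HasAntidiagonal (antidiagonal mem_antidiagonal)

/-! ### Indicator series over `ZMod 2` -/

open Classical in
/-- The series `∑ X ^ n` over the values `n` of `s`, with coefficients in `ZMod 2`. -/
noncomputable def indicatorSeries (s : ℤ → ℕ) : (ZMod 2)⟦X⟧ :=
  PowerSeries.mk fun n => if n ∈ Set.range s then 1 else 0

open Classical in
theorem coeff_indicatorSeries (s : ℤ → ℕ) (n : ℕ) :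
    coeff n (indicatorSeries s) = if n ∈ Set.range s then 1 else 0 := by
  simp only [indicatorSeries, coeff_mk]

theorem expand_indicatorSeries (s : ℤ → ℕ) (c : ℕ) (hc : c ≠ 0) :
    expand c hc (indicatorSeries s) = indicatorSeries fun k => c * s k := by
  classical
  ext n
  rw [coeff_expand, coeff_indicatorSeries, coeff_indicatorSeries]
  by_cases h : c ∣ n
  · obtain ⟨d, rfl⟩ := h
    rw [if_pos (dvd_mul_right _ _), Nat.mul_div_cancel_left _ (Nat.pos_of_ne_zero hc)]
    exact if_congr (by simp [hc]) rfl rfl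
  · rw [if_neg h, if_neg]
    rintro ⟨k, rfl⟩
    exact h (dvd_mul_right _ _)

/-- The pairs `(k, l)` with `s k + t l = m`. -/
noncomputable def sumReps (s t : ℤ → ℕ) (hs : s.Injective) (ht : t.Injective) (m : ℕ) :
    Finset (ℤ × ℤ) :=
  (antidiagonal m).preimage (Prod.map s t) (hs.prodMap ht).injOn

theorem mem_sumReps {s t : ℤ → ℕ} {hs : s.Injective} {ht : t.Injective} {m : ℕ} {x : ℤ × ℤ} :
    x ∈ sumReps s t hs ht m ↔ s x.1 + t x.2 = m := by
  simp [sumReps]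

theorem coeff_indicatorSeries_mul {s t : ℤ → ℕ} (hs : s.Injective) (ht : t.Injective) (m : ℕ) :
    coeff m (indicatorSeries s * indicatorSeries t) = ((sumReps s t hs ht m).card : ZMod 2) := by
  classical
  rw [sumReps, Finset.card_preimage, coeff_mul, Finset.card_filter, Nat.cast_sum]
  refine Finset.sum_congr rfl fun x _ => ?_
  rw [coeff_indicatorSeries, coeff_indicatorSeries, Set.range_prodMap]
  by_cases h1 : x.1 ∈ Set.range s <;> by_cases h2 : x.2 ∈ Set.range t <;> simp [h1, h2]

theorem exists_of_coeff_indicatorSeries_mul_ne_zero {s t : ℤ → ℕ} (hs : s.Injective)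
    (ht : t.Injective) {m : ℕ} (h : coeff m (indicatorSeries s * indicatorSeries t) ≠ 0) :
    ∃ k l, s k + t l = m := by
  rw [coeff_indicatorSeries_mul hs ht] at h
  obtain ⟨x, hx⟩ := Finset.card_ne_zero.1 fun h0 => h (by rw [h0, Nat.cast_zero])
  exact ⟨x.1, x.2, mem_sumReps.1 hx⟩

/-- The Frobenius endomorphism of `(ZMod 2)⟦X⟧` is the substitution `X ↦ X ^ 2`. -/
theorem sq_eq_expand (f : (ZMod 2)⟦X⟧) : f ^ 2 = expand 2 two_ne_zero f := by
  ext n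
  rw [sq, coeff_mul, coeff_expand]
  have hswap : ∀ x ∈ antidiagonal n, x.1 ≠ x.2 →
      coeff x.1 f * coeff x.2 f + coeff x.2 f * coeff x.1 f = 0 := fun x _ _ => by
    rw [mul_comm (coeff x.2 f)]; exact CharTwo.add_self_eq_zero _
  rw [← Finset.sum_filter_add_sum_filter_not _ (fun x : ℕ × ℕ => x.1 = x.2)]
  -- Off-diagonal terms of the square cancel in pairs under the swap.
  rw [Finset.sum_involution (s := (antidiagonal n).filter fun x => ¬ x.1 = x.2)
    (fun x _ => x.swap), add_zero]
  · split_ifs with h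
    · obtain ⟨d, rfl⟩ := h
      rw [Nat.mul_div_cancel_left _ two_pos,
        show (antidiagonal (2 * d)).filter (fun x : ℕ × ℕ => x.1 = x.2) = {(d, d)} by
          ext ⟨a, b⟩
          simp only [Finset.mem_filter, mem_antidiagonal, Finset.mem_singleton,
            Prod.mk.injEq]
          omega, Finset.sum_singleton]
      generalize coeff d f = c
      revert c; decide
    · refine Finset.sum_eq_zero fun x hx => absurd ?_ h
      simp only [Finset.mem_filter, mem_antidiagonal] at hx
      omega
  · intro x hx
    rw [Finset.mem_filter] at hx
    exact hswap x hx.1 hx.2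
  · rintro ⟨a, b⟩ hx _ h
    simp only [Finset.mem_filter, Prod.swap_prod_mk, Prod.mk.injEq] at hx h
    exact hx.2 h.2
  · rintro ⟨a, b⟩ hx
    simp only [Finset.mem_filter, mem_antidiagonal, Prod.swap_prod_mk] at hx ⊢
    omega
  · intro x _
    exact Prod.swap_swap x

/-- Both squares are series in `X ^ 2`, so f and g record the even and odd parts. -/
theorem coeff_two_mul_sq_add (f g : (ZMod 2)⟦X⟧) (n : ℕ) :
    coeff (2 * n) (f ^ 2 + X * g ^ 2) = coeff n f := by
  rw [map_add, sq_eq_expand, sq_eq_expand, coeff_expand_mul]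
  rcases n with _ | n
  · simp
  · rw [show 2 * (n + 1) = (2 * n + 1) + 1 by ring, coeff_succ_X_mul,
      coeff_expand_of_not_dvd _ _ _ (by omega), add_zero]

theorem coeff_two_mul_add_one_sq_add (f g : (ZMod 2)⟦X⟧) (n : ℕ) :
    coeff (2 * n + 1) (f ^ 2 + X * g ^ 2) = coeff n g := by
  rw [map_add, sq_eq_expand, sq_eq_expand, coeff_expand_of_not_dvd _ _ _ (by omega),
    coeff_succ_X_mul, coeff_expand_mul, zero_add]

/-! ### Euler's product modulo two -/

/-- Euler's product `∏ (1 - X ^ n)` modulo two, as the series of the pentagonal numbers. -/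
noncomputable abbrev euler : (ZMod 2)⟦X⟧ := indicatorSeries pentagonal

theorem pentagonalSeries_zmod : pentagonalSeries (ZMod 2) = euler := by
  ext n
  rw [euler, coeff_indicatorSeries]
  split_ifs with h
  · obtain ⟨k, rfl⟩ := h
    rw [coeff_pentagonalSeries_pentagonal]
    rcases Int.units_eq_one_or k.negOnePow with h | h <;> rw [h] <;> decide
  · rw [coeff_pentagonalSeries_eq_zero _ h]

theorem constantCoeff_euler : constantCoeff euler = 1 := by
  rw [← coeff_zero_eq_constantCoeff_apply, euler, coeff_indicatorSeries, if_pos ⟨0, rfl⟩]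

theorem euler_ne_zero : euler ≠ 0 := fun h0 => by simpa [h0] using constantCoeff_euler

/-- The infinite product `∏ (1 - X ^ (c * (n + 1)))` modulo two. -/
theorem hasProd_expand_euler [TopologicalSpace (ZMod 2)] (c : ℕ) (hc : c ≠ 0) :
    HasProd (fun n => (1 - (X ^ c) ^ (n + 1) : (ZMod 2)⟦X⟧)) (expand c hc euler) := by
  have hcont : Continuous (expand (R := ZMod 2) c hc) := by
    rw [continuous_iff_continuousAt]
    intro f
    rw [ContinuousAt, WithPiTopology.tendsto_iff_coeff_tendsto]
    intro d
    simp only [coeff_expand]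
    split_ifs
    · exact (WithPiTopology.continuous_coeff _ _).continuousAt
    · exact tendsto_const_nhds
  have h := (WithPiTopology.hasProd_one_sub_X_pow (ZMod 2)).map (expand c hc) hcont
  rw [pentagonalSeries_zmod] at h
  convert! h using 2 with n
  simp

theorem map_qPoch_X_pow (c : ℕ) (hc : c ≠ 0) (u : ℤ) (hu : Odd u) :
    PowerSeries.map (Int.castRingHom (ZMod 2)) (qPoch (C u * X ^ c) (X ^ c)) =
      expand c hc euler := by
  let : TopologicalSpace (ZMod 2) := ⊥
  have : DiscreteTopology (ZMod 2) := ⟨rfl⟩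
  have hcont : Continuous (PowerSeries.map (Int.castRingHom (ZMod 2))) := by
    rw [continuous_iff_continuousAt]
    intro f
    rw [ContinuousAt, WithPiTopology.tendsto_iff_coeff_tendsto]
    intro d
    simp only [coeff_map]
    exact (continuous_of_discreteTopology.comp
      (WithPiTopology.continuous_coeff ℤ d)).continuousAt
  have hb : constantCoeff (X ^ c : ℤ⟦X⟧) = 0 := by simp [hc]
  have hu' : (u : (ZMod 2)⟦X⟧) = 1 := by
    rw [← map_intCast (C (R := ZMod 2)) u, ZMod.intCast_eq_one_iff_odd.2 hu, map_one]
  have h := (multipliable_qPoch (C u * X ^ c) (X ^ c) hb).hasProd.map _ hcont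
  refine h.unique ?_
  convert! hasProd_expand_euler c hc using 2 with n
  simp [hu', pow_succ']

/-- The numerator reduces to `euler` and cancels one of the four factors `(q; q)_∞`. -/
theorem map_genFun_five :
    PowerSeries.map (Int.castRingHom (ZMod 2)) (genFun 5) *
      (euler ^ 3 * expand 5 (by norm_num) euler) = 1 := by
  have h := congrArg (PowerSeries.map (Int.castRingHom (ZMod 2))) (genFun_mul_denom 5 (by norm_num))
  have h1 := map_qPoch_X_pow 1 one_ne_zero 1 (by decide)
  have h2 := map_qPoch_X_pow 1 one_ne_zero (-1) (by decide)
  have h3 := map_qPoch_X_pow 5 (by norm_num) (-1) (by decide)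
  simp only [map_one, one_mul, pow_one, expand_one_apply, map_neg, neg_mul] at h1 h2 h3
  rw [denom, map_mul, map_mul, map_pow, h1, h2, h3] at h
  refine mul_right_cancel₀ euler_ne_zero ?_
  rw [one_mul]
  refine Eq.trans ?_ h
  ring

/-! ### Gauss's triangular series modulo two -/

/-- The triangular numbers `a (2 a + 1)`, each taken once as `a` runs through `ℤ`. -/
def triangular (a : ℤ) : ℕ := (a * (2 * a + 1)).toNat

theorem natCast_triangular (a : ℤ) : (triangular a : ℤ) = a * (2 * a + 1) := by
  rw [triangular, Int.toNat_of_nonneg]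
  rcases le_or_gt 0 a with h | h
  · positivity
  · exact mul_nonneg_of_nonpos_of_nonpos h.le (by omega)

theorem triangular_injective : Function.Injective triangular := by
  intro a b h
  have h' : a * (2 * a + 1) = b * (2 * b + 1) := by
    rw [← natCast_triangular, ← natCast_triangular, h]
  have : (a - b) * (2 * (a + b) + 1) = 0 := by linear_combination h'
  rcases mul_eq_zero.1 this with h | h <;> omega

section Shanks

variable {K : Type*} [Field K]

/-- The quotient `(1 - X ^ (2 k + 2)) / (1 - X ^ (2 k + 1))`. -/
noncomputable def gaussFactor (K : Type*) [Field K] (k : ℕ) : K⟦X⟧ :=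
  (1 - X ^ (2 * k + 2)) * (1 - X ^ (2 * k + 1))⁻¹

theorem gaussFactor_mul (k : ℕ) :
    gaussFactor K k * (1 - X ^ (2 * k + 1)) = 1 - X ^ (2 * k + 2) := by
  rw [gaussFactor, mul_assoc, PowerSeries.inv_mul_cancel _ (by simp), mul_one]

/-- Shanks's finite form of Gauss's identity for triangular numbers. -/
theorem sum_triangular_eq (n : ℕ) :
    ∑ s ∈ Finset.range n, ((X : K⟦X⟧) ^ (s * (2 * s + 1)) + X ^ ((s + 1) * (2 * s + 1))) =
      ∑ s ∈ Finset.range n, (∏ k ∈ Finset.Ico s n, gaussFactor K k) * X ^ (s * (2 * n + 1)) := by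
  induction n with
  | zero => simp
  | succ n ih =>
    rw [Finset.sum_range_succ, ih]
    set a : ℕ → K⟦X⟧ := fun s =>
      (∏ k ∈ Finset.Ico s n, gaussFactor K k) * X ^ (s * (2 * n + 1)) with ha
    -- Telescoping certificate for the step from n to n + 1: b vanishes at 0, and its value at n + 1
    -- is set separately so that `hstep` also holds at s = n.
    set b : ℕ → K⟦X⟧ := fun s => if s ≤ n then a s * (1 - X ^ (2 * s)) else
      X ^ ((n + 1) * (2 * n + 1)) * (1 - X ^ (2 * n + 1)) with hb
    have hstep : ∀ s ∈ Finset.range (n + 1),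
        a s * (X ^ (2 * n + 1) * (1 - X ^ (2 * s + 1))) = b (s + 1) := by
      intro s hs
      rw [Finset.mem_range, Nat.lt_succ_iff] at hs
      rcases hs.eq_or_lt with rfl | hlt
      · simp only [ha, hb, Finset.Ico_self, Finset.prod_empty, one_mul]
        rw [if_neg (by omega)]
        ring
      · simp only [ha, hb]
        rw [if_pos (by omega), Finset.prod_eq_prod_Ico_succ_bot hlt]
        linear_combination (∏ k ∈ Finset.Ico (s + 1) n, gaussFactor K k) *
          X ^ ((s + 1) * (2 * n + 1)) * gaussFactor_mul (K := K) s
    have hne : (1 - X ^ (2 * n + 1) : K⟦X⟧) ≠ 0 := fun h0 => by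
      simpa using congrArg constantCoeff h0
    refine mul_right_cancel₀ hne ?_
    have hS : ∑ s ∈ Finset.range n, a s + X ^ (n * (2 * n + 1)) =
        ∑ s ∈ Finset.range (n + 1), a s := by
      simp [Finset.sum_range_succ, ha]
    have hT : ∑ s ∈ Finset.range (n + 1),
        (∏ k ∈ Finset.Ico s (n + 1), gaussFactor K k) * X ^ (s * (2 * (n + 1) + 1)) =
        (∑ s ∈ Finset.range (n + 1), a s * X ^ (2 * s)) * gaussFactor K n := by
      rw [Finset.sum_mul]
      refine Finset.sum_congr rfl fun s hs => ?_
      rw [Finset.prod_Ico_succ_top (by simpa [Nat.lt_succ_iff] using hs)]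
      simp only [ha]
      ring
    have htel : ∑ s ∈ Finset.range (n + 1), (b (s + 1) - b s) =
        X ^ ((n + 1) * (2 * n + 1)) * (1 - X ^ (2 * n + 1)) := by
      rw [Finset.sum_range_sub]
      simp [hb]
    have hdiff : ∑ s ∈ Finset.range (n + 1), (b (s + 1) - b s) =
        (∑ s ∈ Finset.range (n + 1), a s * X ^ (2 * s)) * (1 - X ^ (2 * n + 2)) -
          (∑ s ∈ Finset.range (n + 1), a s) * (1 - X ^ (2 * n + 1)) := by
      rw [Finset.sum_mul, Finset.sum_mul, ← Finset.sum_sub_distrib]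
      refine Finset.sum_congr rfl fun s hs => ?_
      rw [← hstep s hs]
      simp only [hb]
      rw [if_pos (by simpa [Nat.lt_succ_iff] using hs)]
      ring
    rw [hT, ← add_assoc, hS]
    linear_combination hdiff - htel -
      (∑ s ∈ Finset.range (n + 1), a s * X ^ (2 * s)) * gaussFactor_mul (K := K) n

end Shanks

open Filter Topology in
theorem tendsto_sum_triangular [TopologicalSpace (ZMod 2)] :
    Tendsto (fun n => ∑ s ∈ Finset.range n,
      ((X : (ZMod 2)⟦X⟧) ^ (s * (2 * s + 1)) + X ^ ((s + 1) * (2 * s + 1)))) atTop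
      (𝓝 (indicatorSeries triangular)) := by
  have hterm : ∀ n : ℕ, ∑ s ∈ Finset.range n,
      ((X : (ZMod 2)⟦X⟧) ^ (s * (2 * s + 1)) + X ^ ((s + 1) * (2 * s + 1))) =
      ∑ a ∈ Finset.Ico (-n : ℤ) n, X ^ triangular a := by
    intro n
    induction n with
    | zero => simp
    | succ n ih =>
      have h1 : triangular n = n * (2 * n + 1) := by
        zify; rw [natCast_triangular]
      have h2 : triangular (-(n + 1 : ℕ)) = (n + 1) * (2 * n + 1) := by
        zify; rw [natCast_triangular]; ring
      have h3 : Finset.Ico (-(n + 1 : ℕ) : ℤ) (n + 1 : ℕ) =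
          -- The two terms at s correspond to the indices s and -(s + 1).
          insert (n : ℤ) (insert (-(n + 1 : ℕ) : ℤ) (Finset.Ico (-n : ℤ) n)) := by
        ext a
        simp only [Finset.mem_Ico, Finset.mem_insert]
        push_cast
        omega
      rw [Finset.sum_range_succ, ih, h3, Finset.sum_insert, Finset.sum_insert, h1, h2]
      · ring
      · simp
      · simp only [Finset.mem_insert, Finset.mem_Ico]
        push_cast
        omega
  simp only [hterm]
  rw [WithPiTopology.tendsto_iff_coeff_tendsto]
  intro d
  refine tendsto_atTop_of_eventually_const (i₀ := d + 1) fun n hn => ?_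
  rw [coeff_indicatorSeries, map_sum]
  simp only [coeff_X_pow]
  split_ifs with h
  · obtain ⟨a, rfl⟩ := h
    simp only [triangular_injective.eq_iff]
    rw [Finset.sum_ite_eq, if_pos]
    have := natCast_triangular a
    rw [Finset.mem_Ico]
    have hn' : (triangular a : ℤ) + 1 ≤ n := by exact_mod_cast hn
    constructor <;> nlinarith
  · exact Finset.sum_eq_zero fun a _ => if_neg fun e => h ⟨a, e.symm⟩

open Filter Topology in
/-- The series of triangular numbers is the cube of Euler's product modulo two. -/
theorem indicatorSeries_triangular : indicatorSeries triangular = euler ^ 3 := by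
  let : TopologicalSpace (ZMod 2) := ⊥
  have : DiscreteTopology (ZMod 2) := ⟨rfl⟩
  have hP : Tendsto (fun n => ∏ k ∈ Finset.range n, gaussFactor (ZMod 2) k) atTop
      (𝓝 (indicatorSeries triangular)) := by
    have h := tendsto_sum_triangular
    rw [WithPiTopology.tendsto_iff_coeff_tendsto] at h ⊢
    intro d
    refine (h d).congr' ?_
    filter_upwards [eventually_gt_atTop d] with n hn
    obtain ⟨n, rfl⟩ := Nat.exists_eq_succ_of_ne_zero (by omega : n ≠ 0)
    -- Terms with s ≥ 1 have order above d; only the full product at s = 0 survives.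
    rw [sum_triangular_eq, Finset.sum_range_succ', map_add, map_sum, Finset.sum_eq_zero, zero_add]
    · simp
    · intro s _
      rw [coeff_mul_X_pow', if_neg]
      nlinarith
  have hF : Tendsto (fun n => ∏ k ∈ Finset.range (2 * n), (1 - X ^ (k + 1) : (ZMod 2)⟦X⟧)) atTop
      (𝓝 euler) := by
    have h := (WithPiTopology.hasProd_one_sub_X_pow (ZMod 2)).tendsto_prod_nat
    rw [pentagonalSeries_zmod] at h
    exact h.comp (tendsto_id.const_mul_atTop' two_pos)
  have hE := (hasProd_expand_euler 2 two_ne_zero).tendsto_prod_nat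
  -- In the limit ψ F = F(q^2)^2, which is F^4 modulo 2; cancel F.
  have hfin : ∀ n, (∏ k ∈ Finset.range n, gaussFactor (ZMod 2) k) *
      ∏ k ∈ Finset.range (2 * n), (1 - X ^ (k + 1) : (ZMod 2)⟦X⟧) =
      (∏ k ∈ Finset.range n, (1 - (X ^ 2) ^ (k + 1) : (ZMod 2)⟦X⟧)) ^ 2 := by
    intro n
    induction n with
    | zero => simp
    | succ n ih =>
      rw [show 2 * (n + 1) = 2 * n + 1 + 1 by ring]
      simp only [Finset.prod_range_succ]
      rw [mul_pow, ← ih]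
      have h := gaussFactor_mul (K := ZMod 2) n
      linear_combination (∏ k ∈ Finset.range n, gaussFactor (ZMod 2) k) *
        (∏ k ∈ Finset.range (2 * n), (1 - X ^ (k + 1) : (ZMod 2)⟦X⟧)) *
          (1 - X ^ (2 * n + 2)) * h
  have hlim := tendsto_nhds_unique ((hP.mul hF).congr hfin) (hE.pow 2)
  rw [← sq_eq_expand] at hlim
  refine mul_right_cancel₀ euler_ne_zero (hlim.trans ?_)
  ring

/-! ### Representations by `x ^ 2 + 5 y ^ 2` -/

theorem twentyFour_mul_pentagonal_add_one (k : ℤ) :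
    24 * (pentagonal k : ℤ) + 1 = (6 * k - 1) ^ 2 := by
  linear_combination 12 * two_mul_natCast_pentagonal k

/-- The integer `k` with `6 k - 1 = ± u`, for `u` coprime to `6`. -/
def pentagonalIndex (u : ℤ) : ℤ := if u % 6 = 5 then (u + 1) / 6 else (1 - u) / 6

theorem pentagonalIndex_spec {u : ℤ} (h2 : u % 2 = 1) (h3 : u % 3 ≠ 0) :
    6 * pentagonalIndex u - 1 = u ∨ 6 * pentagonalIndex u - 1 = -u := by
  have h6 : u % 6 = 1 ∨ u % 6 = 5 := by omega
  rw [pentagonalIndex]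
  split_ifs <;> omega

theorem twentyFour_mul_pentagonal_pentagonalIndex {u : ℤ} (h2 : u % 2 = 1) (h3 : u % 3 ≠ 0) :
    24 * (pentagonal (pentagonalIndex u) : ℤ) + 1 = u ^ 2 := by
  rw [twentyFour_mul_pentagonal_add_one]
  rcases pentagonalIndex_spec h2 h3 with h | h <;> rw [h]
  exact neg_sq u

theorem injective_mul_comp {s : ℤ → ℕ} (hs : s.Injective) {c : ℕ} (hc : 0 < c) :
    Function.Injective fun k => c * s k :=
  fun _ _ h => hs (Nat.eq_of_mul_eq_mul_left hc h)

theorem mem_sumReps_triangular {m : ℕ} {a b : ℤ} :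
    (a, b) ∈ sumReps triangular (fun b => 5 * triangular b) triangular_injective
      (injective_mul_comp triangular_injective (by norm_num)) m ↔
      a * (2 * a + 1) + 5 * (b * (2 * b + 1)) = m := by
  rw [mem_sumReps]
  zify
  rw [natCast_triangular, natCast_triangular]

theorem add_emod_two_of_mem {m : ℕ} {a b : ℤ}
    (h : a * (2 * a + 1) + 5 * (b * (2 * b + 1)) = m) : (a + b) % 2 = m % 2 := by
  have : 2 * (a ^ 2 + 5 * b ^ 2) + a + 5 * b = m := by linear_combination h
  omega

/-- A finite set carrying a fixed point free involution has even cardinality. -/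
theorem natCast_card_eq_zero_of_involution {ι : Type*} (s : Finset ι) (g : ι → ι)
    (hmem : ∀ x ∈ s, g x ∈ s) (hne : ∀ x ∈ s, g x ≠ x) (hinv : ∀ x ∈ s, g (g x) = x) :
    (s.card : ZMod 2) = 0 := by
  rw [Finset.card_eq_sum_ones, Nat.cast_sum]
  exact Finset.sum_involution (fun x _ => g x) (fun _ _ => by decide) (fun x hx _ => hne x hx)
    hmem hinv

/-- Put u = a - 5b - 1 and v = 2(a + b) + 1, so that 4u^2 + 5v^2 = 12m + 9: up to scaling, this
multiplies (4a+1) + (4b+1)√-5 by an element of norm 6. Here u is odd, v ≡ 1 mod 4 and u ≡ -v mod 3.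
If 3 divides v, then u ↦ -u is an involution without fixed points. Otherwise u and v are prime to 6
and, up to sign, of the form 6k - 1; the congruences fix the signs. -/
theorem natCast_card_sumReps_of_even {m : ℕ} (hm : m % 2 = 0) :
    ((sumReps triangular (fun b => 5 * triangular b) triangular_injective
      (injective_mul_comp triangular_injective (by norm_num)) m).card : ZMod 2) =
    ((sumReps (fun k => 8 * pentagonal k) (fun k => 10 * pentagonal k)
      (injective_mul_comp pentagonal_injective (by norm_num))
      (injective_mul_comp pentagonal_injective (by norm_num)) m).card : ZMod 2) := by
  set S := sumReps triangular (fun b => 5 * triangular b) triangular_injective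
      (injective_mul_comp triangular_injective (by norm_num)) m
  rw [← Finset.card_filter_add_card_filter_not
    (s := S) (fun x : ℤ × ℤ => (2 * (x.1 + x.2) + 1) % 3 = 0), Nat.cast_add]
  rw [natCast_card_eq_zero_of_involution (S.filter _)
    fun x => (x.1 - (x.1 - 5 * x.2 - 1) / 3, x.2 + (x.1 - 5 * x.2 - 1) / 3), zero_add]
  · congr 1
    refine Finset.card_bij (fun x _ => (pentagonalIndex (x.1 - 5 * x.2 - 1),
      pentagonalIndex (2 * (x.1 + x.2) + 1))) ?_ ?_ ?_
    · rintro ⟨a, b⟩ hx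
      rw [Finset.mem_filter, mem_sumReps_triangular] at hx
      obtain ⟨hx, h3⟩ := hx
      have h2 := add_emod_two_of_mem hx
      have hP := twentyFour_mul_pentagonal_pentagonalIndex (u := a - 5 * b - 1) (by omega)
        (by omega)
      have hQ := twentyFour_mul_pentagonal_pentagonalIndex (u := 2 * (a + b) + 1) (by omega)
        (by omega)
      rw [mem_sumReps]
      zify
      linarith
    · rintro ⟨a, b⟩ hx ⟨a', b'⟩ hx' h
      rw [Finset.mem_filter, mem_sumReps_triangular] at hx hx'
      simp only [Prod.mk.injEq] at h
      have h2 := add_emod_two_of_mem hx.1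
      have h2' := add_emod_two_of_mem hx'.1
      have h3 := hx.2
      have h3' := hx'.2
      have hu := pentagonalIndex_spec (u := a - 5 * b - 1) (by omega) (by omega)
      have hu' := pentagonalIndex_spec (u := a' - 5 * b' - 1) (by omega) (by omega)
      have hv := pentagonalIndex_spec (u := 2 * (a + b) + 1) (by omega) (by omega)
      have hv' := pentagonalIndex_spec (u := 2 * (a' + b') + 1) (by omega) (by omega)
      rw [Prod.mk.injEq]
      omega
    · rintro ⟨k, l⟩ hx
      rw [mem_sumReps] at hx
      zify at hx
      have hP := twentyFour_mul_pentagonal_add_one k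
      have hQ := twentyFour_mul_pentagonal_add_one l
      obtain ⟨v, hv, hv4⟩ : ∃ v, (v = 6 * l - 1 ∨ v = -(6 * l - 1)) ∧ v % 4 = 1 := by
        rcases Int.emod_two_eq_zero_or_one l with h | h
        · exact ⟨-(6 * l - 1), Or.inr rfl, by omega⟩
        · exact ⟨6 * l - 1, Or.inl rfl, by omega⟩
      obtain ⟨u, hu, hu3⟩ : ∃ u, (u = 6 * k - 1 ∨ u = -(6 * k - 1)) ∧ (u + v) % 3 = 0 := by
        by_cases h : (6 * k - 1 + v) % 3 = 0
        · exact ⟨6 * k - 1, Or.inl rfl, h⟩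
        · exact ⟨-(6 * k - 1), Or.inr rfl, by omega⟩
      -- The sign choices modulo 4 and 3 are what make this division by 12 exact.
      obtain ⟨b, hb⟩ : ∃ b, v = 2 * u + 3 + 12 * b := ⟨(v - 3 - 2 * u) / 12, by omega⟩
      have hu2 : u ^ 2 = (6 * k - 1) ^ 2 := sq_eq_sq_iff_eq_or_eq_neg.2 hu
      have hv2 : v ^ 2 = (6 * l - 1) ^ 2 := sq_eq_sq_iff_eq_or_eq_neg.2 hv
      refine ⟨(u + 1 + 5 * b, b), ?_, ?_⟩
      · rw [Finset.mem_filter, mem_sumReps_triangular]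
        refine ⟨?_, by omega⟩
        have : 12 * (m : ℤ) + 9 = 4 * u ^ 2 + 5 * v ^ 2 := by linarith
        rw [hb] at this
        linarith
      · have h1 := pentagonalIndex_spec (u := u) (by omega) (by omega)
        have h2 := pentagonalIndex_spec (u := v) (by omega) (by omega)
        rw [Prod.mk.injEq]
        dsimp only
        rw [show u + 1 + 5 * b - 5 * b - 1 = u by ring,
          show 2 * (u + 1 + 5 * b + b) + 1 = v by rw [hb]; ring]
        omega
  · rintro ⟨a, b⟩ hx
    rw [Finset.mem_filter, mem_sumReps_triangular] at hx ⊢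
    obtain ⟨hx, h3⟩ := hx
    dsimp only at h3 ⊢
    obtain ⟨w, hw⟩ : ∃ w, a = 5 * b + 1 + 3 * w := ⟨(a - 5 * b - 1) / 3, by omega⟩
    rw [show (a - 5 * b - 1) / 3 = w by omega]
    refine ⟨?_, by omega⟩
    rw [← hx, hw]
    ring
  · rintro ⟨a, b⟩ hx h
    rw [Finset.mem_filter, mem_sumReps_triangular] at hx
    have h2 := add_emod_two_of_mem hx.1
    simp only [Prod.mk.injEq] at h hx
    omega
  · rintro ⟨a, b⟩ hx
    rw [Finset.mem_filter] at hx
    simp only [Prod.mk.injEq] at hx ⊢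
    omega

/-- The conjugate multiplier serves here: u = 2a + 10b + 3 and v = b - a give u^2 + 20v^2 = 12m +
21, with v odd, u ≡ 1 mod 4 and u ≡ v mod 3. The involution is v ↦ -v when 3 divides v. -/
theorem natCast_card_sumReps_of_odd {m : ℕ} (hm : m % 2 = 0) :
    ((sumReps triangular (fun b => 5 * triangular b) triangular_injective
      (injective_mul_comp triangular_injective (by norm_num)) (m + 1)).card : ZMod 2) =
    ((sumReps (fun k => 2 * pentagonal k) (fun k => 40 * pentagonal k)
      (injective_mul_comp pentagonal_injective (by norm_num))
      (injective_mul_comp pentagonal_injective (by norm_num)) m).card : ZMod 2) := by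
  set S := sumReps triangular (fun b => 5 * triangular b) triangular_injective
      (injective_mul_comp triangular_injective (by norm_num)) (m + 1)
  rw [← Finset.card_filter_add_card_filter_not
    (s := S) (fun x : ℤ × ℤ => (x.2 - x.1) % 3 = 0), Nat.cast_add]
  rw [natCast_card_eq_zero_of_involution (S.filter _)
    fun x => (x.1 + 5 * ((x.2 - x.1) / 3), x.2 - (x.2 - x.1) / 3), zero_add]
  · congr 1
    refine Finset.card_bij (fun x _ => (pentagonalIndex (2 * x.1 + 10 * x.2 + 3),
      pentagonalIndex (x.2 - x.1))) ?_ ?_ ?_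
    · rintro ⟨a, b⟩ hx
      rw [Finset.mem_filter, mem_sumReps_triangular] at hx
      obtain ⟨hx, h3⟩ := hx
      have h2 := add_emod_two_of_mem hx
      have hP := twentyFour_mul_pentagonal_pentagonalIndex (u := 2 * a + 10 * b + 3) (by omega)
        (by omega)
      have hQ := twentyFour_mul_pentagonal_pentagonalIndex (u := b - a) (by omega)
        (by omega)
      rw [mem_sumReps]
      zify
      push_cast at hx
      linarith
    · rintro ⟨a, b⟩ hx ⟨a', b'⟩ hx' h
      rw [Finset.mem_filter, mem_sumReps_triangular] at hx hx'
      simp only [Prod.mk.injEq] at h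
      have h2 := add_emod_two_of_mem hx.1
      have h2' := add_emod_two_of_mem hx'.1
      have h3 := hx.2
      have h3' := hx'.2
      have hu := pentagonalIndex_spec (u := 2 * a + 10 * b + 3) (by omega) (by omega)
      have hu' := pentagonalIndex_spec (u := 2 * a' + 10 * b' + 3) (by omega) (by omega)
      have hv := pentagonalIndex_spec (u := b - a) (by omega) (by omega)
      have hv' := pentagonalIndex_spec (u := b' - a') (by omega) (by omega)
      rw [Prod.mk.injEq]
      omega
    · rintro ⟨k, l⟩ hx
      rw [mem_sumReps] at hx
      zify at hx
      have hP := twentyFour_mul_pentagonal_add_one k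
      have hQ := twentyFour_mul_pentagonal_add_one l
      obtain ⟨u, hu, hu4⟩ : ∃ u, (u = 6 * k - 1 ∨ u = -(6 * k - 1)) ∧ u % 4 = 1 := by
        rcases Int.emod_two_eq_zero_or_one k with h | h
        · exact ⟨-(6 * k - 1), Or.inr rfl, by omega⟩
        · exact ⟨6 * k - 1, Or.inl rfl, by omega⟩
      obtain ⟨v, hv, hv3⟩ : ∃ v, (v = 6 * l - 1 ∨ v = -(6 * l - 1)) ∧ (u - v) % 3 = 0 := by
        by_cases h : (u - (6 * l - 1)) % 3 = 0
        · exact ⟨6 * l - 1, Or.inl rfl, h⟩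
        · exact ⟨-(6 * l - 1), Or.inr rfl, by omega⟩
      obtain ⟨b, hb⟩ : ∃ b, u = 12 * b - 2 * v + 3 := ⟨(u + 2 * v - 3) / 12, by omega⟩
      have hu2 : u ^ 2 = (6 * k - 1) ^ 2 := sq_eq_sq_iff_eq_or_eq_neg.2 hu
      have hv2 : v ^ 2 = (6 * l - 1) ^ 2 := sq_eq_sq_iff_eq_or_eq_neg.2 hv
      refine ⟨(b - v, b), ?_, ?_⟩
      · rw [Finset.mem_filter, mem_sumReps_triangular]
        refine ⟨?_, by omega⟩
        have : 12 * (m : ℤ) + 21 = u ^ 2 + 20 * v ^ 2 := by linarith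
        rw [hb] at this
        push_cast
        linarith
      · have h1 := pentagonalIndex_spec (u := u) (by omega) (by omega)
        have h2 := pentagonalIndex_spec (u := v) (by omega) (by omega)
        rw [Prod.mk.injEq]
        dsimp only
        rw [show 2 * (b - v) + 10 * b + 3 = u by rw [hb]; ring, show b - (b - v) = v by ring]
        omega
  · rintro ⟨a, b⟩ hx
    rw [Finset.mem_filter, mem_sumReps_triangular] at hx ⊢
    obtain ⟨hx, h3⟩ := hx
    dsimp only at h3 ⊢
    obtain ⟨w, hw⟩ : ∃ w, b = a + 3 * w := ⟨(b - a) / 3, by omega⟩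
    rw [show (b - a) / 3 = w by omega]
    refine ⟨?_, by omega⟩
    rw [← hx, hw]
    ring
  · rintro ⟨a, b⟩ hx h
    rw [Finset.mem_filter, mem_sumReps_triangular] at hx
    have h2 := add_emod_two_of_mem hx.1
    simp only [Prod.mk.injEq] at h hx
    omega
  · rintro ⟨a, b⟩ hx
    rw [Finset.mem_filter] at hx
    simp only [Prod.mk.injEq] at hx ⊢
    omega

/-! ### The modular equation of degree five -/

theorem triangular_mul_triangular :
    indicatorSeries triangular * expand 5 (by norm_num) (indicatorSeries triangular) =
      expand 8 (by norm_num) euler * expand 10 (by norm_num) euler +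
        X * (expand 2 (by norm_num) euler * expand 40 (by norm_num) euler) := by
  have hinj : ∀ c : ℕ, 0 < c → Function.Injective fun k => c * pentagonal k :=
    fun c hc => injective_mul_comp pentagonal_injective hc
  simp only [euler, expand_indicatorSeries]
  ext m
  rw [coeff_indicatorSeries_mul triangular_injective
    (injective_mul_comp triangular_injective (by norm_num)), map_add]
  rcases Nat.mod_two_eq_zero_or_one m with hm | hm
  · rw [natCast_card_sumReps_of_even hm, ← coeff_indicatorSeries_mul, left_eq_add]
    rcases m with _ | m
    · simp
    · rw [coeff_succ_X_mul]
      by_contra h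
      obtain ⟨k, l, h⟩ := exists_of_coeff_indicatorSeries_mul_ne_zero (hinj 2 (by norm_num))
        (hinj 40 (by norm_num)) h
      omega
  · obtain ⟨m, rfl⟩ := Nat.exists_eq_succ_of_ne_zero (by omega : m ≠ 0)
    rw [natCast_card_sumReps_of_odd (by omega), ← coeff_indicatorSeries_mul, coeff_succ_X_mul,
      right_eq_add]
    by_contra h
    obtain ⟨k, l, h⟩ := exists_of_coeff_indicatorSeries_mul_ne_zero (hinj 8 (by norm_num))
      (hinj 10 (by norm_num)) h
    omega

theorem constantCoeff_expand_euler (c : ℕ) (hc : c ≠ 0) :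
    constantCoeff (expand c hc euler) = 1 := by
  rw [constantCoeff_expand, constantCoeff_euler]

/-- The modular equation of degree five between the Euler products, modulo two. -/
theorem euler_mul_expand_five :
    euler * expand 5 (by norm_num) euler =
      euler ^ 6 + X * expand 5 (by norm_num) euler ^ 6 := by
  have h := triangular_mul_triangular
  set G := expand 5 (by norm_num) euler with hG
  have h2 : expand 2 two_ne_zero euler = euler ^ 2 := (sq_eq_expand _).symm
  have h8 : expand 8 (by norm_num) euler = euler ^ 8 := by
    rw [show euler ^ 8 = ((euler ^ 2) ^ 2) ^ 2 by ring]
    simp only [sq_eq_expand, ← expand_mul]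
  have h10 : expand 10 (by norm_num) euler = G ^ 2 := by
    simp only [sq_eq_expand, hG, ← expand_mul]
  have h40 : expand 40 (by norm_num) euler = G ^ 8 := by
    rw [show G ^ 8 = ((G ^ 2) ^ 2) ^ 2 by ring]
    simp only [sq_eq_expand, hG, ← expand_mul]
  rw [indicatorSeries_triangular, map_pow, h2, h8, h10, h40, ← hG] at h
  have hG0 : G ≠ 0 := fun h0 => by
    simpa [← hG, h0] using constantCoeff_expand_euler 5 (by norm_num)
  refine mul_right_cancel₀ (pow_ne_zero 2 (mul_ne_zero euler_ne_zero hG0)) ?_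
  linear_combination h

/-! ### Dissection of the generating function -/

/-- The terms of Euler's product with exponent `1` modulo five. -/
theorem coeff_five_mul_add_one_euler (n : ℕ) :
    coeff (5 * n + 1) euler = coeff n (expand 5 (by norm_num) euler) := by
  classical
  rw [expand_indicatorSeries, coeff_indicatorSeries, coeff_indicatorSeries]
  refine if_congr ⟨?_, ?_⟩ rfl rfl
  · rintro ⟨k, hk⟩
    have h := two_mul_natCast_pentagonal k
    rw [hk] at h
    -- 24(5n + 1) + 1 is divisible by 5; the resulting k = 1 - 5l has pentagonal number 1 + 25
    -- `pentagonal l`.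
    have h5 : (6 * k - 1) % 5 = 0 := by
      have h0 : (6 * k - 1) ^ 2 = 5 * (24 * n + 5) := by push_cast at h; linear_combination -12 * h
      exact Int.emod_eq_zero_of_dvd
        ((Nat.prime_iff_prime_int.1 Nat.prime_five).dvd_of_dvd_pow (Dvd.intro _ h0.symm))
    obtain ⟨l, hl⟩ : ∃ l, k = 1 - 5 * l := ⟨(1 - k) / 5, by omega⟩
    refine ⟨l, ?_⟩
    have h' := two_mul_natCast_pentagonal l
    zify
    rw [hl] at h
    push_cast at h
    linarith
  · rintro ⟨l, hl⟩
    refine ⟨1 - 5 * l, ?_⟩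
    have h := two_mul_natCast_pentagonal l
    have h' := two_mul_natCast_pentagonal (1 - 5 * l)
    zify at hl ⊢
    linarith

/-- A factor in `X ^ c` preserves residue classes of exponents, so it passes through the dissection.
-/
theorem coeff_mul_expand_of_coeff {R : Type*} [CommRing R] {c r : ℕ} (hc : c ≠ 0) (hr : r < c)
    {f g : R⟦X⟧} (h : ∀ n, coeff (c * n + r) f = coeff n g) (e : R⟦X⟧) (n : ℕ) :
    coeff (c * n + r) (f * expand c hc e) = coeff n (g * e) := by
  have hc' := Nat.pos_of_ne_zero hc
  rw [coeff_mul, coeff_mul]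
  symm
  refine Finset.sum_of_injOn (fun x => (c * x.1 + r, c * x.2)) ?_ ?_ ?_ ?_
  · rintro ⟨a, b⟩ _ ⟨a', b'⟩ _ hab
    simp only [Prod.mk.injEq, add_left_inj] at hab
    exact Prod.ext (Nat.eq_of_mul_eq_mul_left hc' hab.1) (Nat.eq_of_mul_eq_mul_left hc' hab.2)
  · rintro ⟨a, b⟩ hx
    simp only [Finset.mem_coe, Finset.HasAntidiagonal.mem_antidiagonal] at hx ⊢
    rw [← hx]; ring
  · rintro ⟨a, b⟩ hx hnot
    rw [Finset.HasAntidiagonal.mem_antidiagonal] at hx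
    rw [coeff_expand_of_not_dvd, mul_zero]
    rintro ⟨d, hd⟩
    refine hnot ?_
    dsimp only at hx hd
    have hdn : d ≤ n := by
      by_contra hlt
      have : c * (n + 1) ≤ c * d := Nat.mul_le_mul_left c (by omega)
      rw [mul_add] at this
      omega
    refine ⟨(n - d, d), ?_, ?_⟩
    · simp only [Finset.mem_coe, Finset.HasAntidiagonal.mem_antidiagonal]
      omega
    · obtain ⟨t, rfl⟩ := Nat.exists_eq_add_of_le hdn
      rw [mul_add] at hx
      simp only [Nat.add_sub_cancel_left, Prod.mk.injEq]
      omega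
  · rintro ⟨a, b⟩ _
    rw [h, coeff_expand_mul]

theorem bracelet_five_forty_mul_add_twelve (m : ℕ) :
    ((bracelet 5 (40 * m + 12) : ℤ) : ZMod 2) =
      coeff m (expand 2 two_ne_zero euler * expand 5 (by norm_num) euler) := by
  have hmain := euler_mul_expand_five
  have hg := map_genFun_five
  set g := PowerSeries.map (Int.castRingHom (ZMod 2)) (genFun 5) with hgdef
  set F := euler with hF
  set G := expand 5 (by norm_num) F with hG
  have hFi : F * F⁻¹ = 1 := PowerSeries.mul_inv_cancel _ (by rw [constantCoeff_euler]; decide)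
  have hGi : G * G⁻¹ = 1 :=
    PowerSeries.mul_inv_cancel _ (by rw [hG, constantCoeff_expand_euler]; decide)
  have hGi' : expand 5 (by norm_num) F⁻¹ = G⁻¹ := by
    have h := congrArg (expand 5 (by norm_num)) hFi
    rw [map_mul, map_one, ← hG] at h
    exact (mul_left_cancel₀ (left_ne_zero_of_mul_eq_one hGi) (h.trans hGi.symm))
  -- The modular equation divided by F^4 G^2; `e2` divides it by F^2.
  have e1 : g = (F * G⁻¹) ^ 2 + X * (G ^ 2 * (F⁻¹) ^ 2) ^ 2 := by
    have hne : F ^ 4 * G ^ 2 ≠ 0 := mul_ne_zero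
      (pow_ne_zero _ (left_ne_zero_of_mul_eq_one hFi))
      (pow_ne_zero _ (left_ne_zero_of_mul_eq_one hGi))
    refine mul_right_cancel₀ hne ?_
    calc g * (F ^ 4 * G ^ 2) = g * (F ^ 3 * G) * (F * G) := by ring
      _ = F ^ 6 * 1 ^ 2 + X * G ^ 6 * 1 ^ 4 := by rw [hg, hmain]; ring
      _ = _ := by rw [← hGi]; nth_rw 2 [hGi]; rw [← hFi]; ring
  have e2 : G * F⁻¹ = (F ^ 2) ^ 2 + X * (G ^ 3 * F⁻¹) ^ 2 := by
    refine mul_right_cancel₀ (pow_ne_zero 2 (left_ne_zero_of_mul_eq_one hFi)) ?_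
    calc G * F⁻¹ * F ^ 2 = F * F⁻¹ * (F * G) := by ring
      _ = F ^ 6 + X * G ^ 6 * 1 ^ 2 := by rw [hFi, hmain]; ring
      _ = _ := by rw [← hFi]; ring
  have e3 : G ^ 3 * F⁻¹ = (F ^ 2 * G) ^ 2 + X * (G ^ 4 * F⁻¹) ^ 2 := by
    linear_combination G ^ 2 * e2
  have hb : ((bracelet 5 (40 * m + 12) : ℤ) : ZMod 2) = coeff (40 * m + 12) g := by
    rw [hgdef, coeff_map]; rfl
  -- Successive parts: even gives F/G, 5n + 1 gives G/F, odd gives G^3/F, even gives F^2 G.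
  rw [hb, show 40 * m + 12 = 2 * (5 * (2 * (2 * m) + 1) + 1) by ring, e1, coeff_two_mul_sq_add,
    ← hGi', coeff_mul_expand_of_coeff (by norm_num) (by norm_num) coeff_five_mul_add_one_euler,
    ← hG, e2, coeff_two_mul_add_one_sq_add, e3, coeff_two_mul_sq_add, sq_eq_expand]

/-! ### The quadratic form `2 x ^ 2 + 5 y ^ 2` -/

theorem dvd_of_dvd_two_mul_sq_add_five_mul_sq {p : ℕ} [Fact p.Prime] (hp : 5 < p)
    (hleg : legendreSym p (-10) = -1) {x y : ℤ} (h : (p : ℤ) ∣ 2 * x ^ 2 + 5 * y ^ 2) :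
    (p : ℤ) ∣ x ∧ (p : ℤ) ∣ y := by
  have hp' : Prime (p : ℤ) := Nat.prime_iff_prime_int.1 Fact.out
  have h2 : ¬ (p : ℤ) ∣ 2 := fun h => by have := Int.le_of_dvd (by norm_num) h; omega
  have h5 : ¬ (p : ℤ) ∣ 5 := fun h => by have := Int.le_of_dvd (by norm_num) h; omega
  have hy : (p : ℤ) ∣ y := by
    by_contra hy
    have hy0 : (y : ZMod p) ≠ 0 := fun h => hy ((ZMod.intCast_zmod_eq_zero_iff_dvd y p).1 h)
    have h0 : (2 * x ^ 2 + 5 * y ^ 2 : ZMod p) = 0 := by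
      exact_mod_cast (ZMod.intCast_zmod_eq_zero_iff_dvd _ p).2 h
    -- 2x^2 = -5y^2 makes (2x/y)^2 = -10.
    refine legendreSym.eq_neg_one_iff p |>.1 hleg ⟨2 * x * (y : ZMod p)⁻¹, ?_⟩
    push_cast
    field_simp
    linear_combination (-2) * h0
  refine ⟨?_, hy⟩
  have h' : (p : ℤ) ∣ 2 * x ^ 2 :=
    (dvd_add_left ((dvd_pow hy two_ne_zero).mul_left 5)).1 h
  exact hp'.dvd_of_dvd_pow ((hp'.dvd_or_dvd h').resolve_left h2)

/-- Descent: p divides both x and y, so p^2 cancels until the exponent is 1, where p would divide c.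
-/
theorem two_mul_sq_add_five_mul_sq_ne {p : ℕ} [Fact p.Prime] (hp : 5 < p)
    (hleg : legendreSym p (-10) = -1) {c : ℤ} (hc : ¬ (p : ℤ) ∣ c) (t : ℕ) :
    ∀ x y : ℤ, 2 * x ^ 2 + 5 * y ^ 2 ≠ p ^ (2 * t + 1) * c := by
  have hp0 : (p : ℤ) ≠ 0 := by exact_mod_cast (Fact.out : p.Prime).ne_zero
  induction t with
  | zero =>
    intro x y h
    rw [mul_zero, zero_add, pow_one] at h
    obtain ⟨⟨a, rfl⟩, ⟨b, rfl⟩⟩ :=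
      dvd_of_dvd_two_mul_sq_add_five_mul_sq hp hleg (Dvd.intro _ h.symm)
    refine hc ⟨2 * a ^ 2 + 5 * b ^ 2, mul_left_cancel₀ hp0 ?_⟩
    linear_combination -h
  | succ t ih =>
    intro x y h
    obtain ⟨⟨a, rfl⟩, ⟨b, rfl⟩⟩ := dvd_of_dvd_two_mul_sq_add_five_mul_sq hp hleg
      (x := x) (y := y) ⟨p ^ (2 * t + 2) * c, by rw [h]; ring⟩
    refine ih a b (mul_left_cancel₀ (pow_ne_zero 2 hp0) ?_)
    linear_combination h

end BraceletPartition

/-! ### The congruence -/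

theorem mainTheorem1 (p : ℕ) [Fact p.Prime] (hp : 5 ≤ p) (hleg : legendreSym p (-10) = -1)
    (α : ℕ) (hα : 1 ≤ α) (n i : ℕ) (hi : 1 ≤ i) (hip : i ≤ p - 1) :
    3 ∣ 5 * (24 * i + 7 * p) * p ^ (2 * α - 1) + 1 ∧
      BraceletPartition.bracelet 5
        (40 * p ^ (2 * α) * n + (5 * (24 * i + 7 * p) * p ^ (2 * α - 1) + 1) / 3) ≡ 0 [ZMOD 2] := by
  have hpp : p.Prime := Fact.out
  have hp5 : 5 < p := by
    refine lt_of_le_of_ne hp ?_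
    rintro rfl
    rw [(legendreSym.eq_zero_iff 5 (-10)).2
      ((ZMod.intCast_zmod_eq_zero_iff_dvd (-10) 5).2 (by norm_num))] at hleg
    norm_num at hleg
  obtain ⟨t, rfl⟩ : ∃ t, α = t + 1 := ⟨α - 1, by omega⟩
  rw [show 2 * (t + 1) - 1 = 2 * t + 1 by omega, show 2 * (t + 1) = 2 * t + 1 + 1 by ring]
  -- Squares of integers prime to 6 are 1 modulo 24; this puts the argument in the form 40m + 12.
  obtain ⟨d, hd⟩ : ∃ d, p ^ (2 * t + 1 + 1) = 24 * d + 1 := by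
    have hcop : (p ^ (t + 1)).Coprime 6 :=
      Nat.Coprime.pow_left _ (((Nat.coprime_primes hpp Nat.prime_two).2 (by omega)).mul_right
        ((Nat.coprime_primes hpp Nat.prime_three).2 (by omega)))
    rw [show p ^ (2 * t + 1 + 1) = (p ^ (t + 1)) ^ 2 by ring]
    generalize p ^ (t + 1) = q at hcop
    have h24 : q ^ 2 % 24 = 1 := by
      have hq : q % 24 < 24 := Nat.mod_lt _ (by norm_num)
      have hcop' : (q % 24).gcd 6 = 1 := by
        rw [Nat.gcd_comm, Nat.gcd_rec, Nat.mod_mod_of_dvd _ (by norm_num), ← Nat.gcd_rec,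
          Nat.gcd_comm]
        exact hcop
      rw [Nat.pow_mod]
      generalize q % 24 = z at hq hcop'
      interval_cases z <;> revert hcop' <;> decide
    exact ⟨q ^ 2 / 24, by omega⟩
  have hpr : p * p ^ (2 * t + 1) = 24 * d + 1 := by rw [← hd, pow_succ' _ (2 * t + 1)]
  have hval : 5 * (24 * i + 7 * p) * p ^ (2 * t + 1) + 1 =
      3 * (40 * (i * p ^ (2 * t + 1) + 7 * d) + 12) := by
    linear_combination 35 * hpr
  refine ⟨Dvd.intro _ hval.symm, ?_⟩
  rw [hval, Nat.mul_div_cancel_left _ (by norm_num),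
    show 40 * p ^ (2 * t + 1 + 1) * n + (40 * (i * p ^ (2 * t + 1) + 7 * d) + 12) =
      40 * (p ^ (2 * t + 1 + 1) * n + i * p ^ (2 * t + 1) + 7 * d) + 12 by ring]
  refine (ZMod.intCast_eq_intCast_iff _ _ 2).1 ?_
  rw [BraceletPartition.bracelet_five_forty_mul_add_twelve, Int.cast_zero]
  by_contra hne
  rw [BraceletPartition.expand_indicatorSeries, BraceletPartition.expand_indicatorSeries] at hne
  obtain ⟨k, l, hkl⟩ := BraceletPartition.exists_of_coeff_indicatorSeries_mul_ne_zero
    (BraceletPartition.injective_mul_comp pentagonal_injective (by norm_num))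
    (BraceletPartition.injective_mul_comp pentagonal_injective (by norm_num)) hne
  -- This is the cofactor of p^(2t+1) in 24m + 7; it is prime to p because 0 < i < p.
  have hc : ¬ (p : ℤ) ∣ 24 * (p * n + i) + 7 * p := by
    intro h
    have h' : p ∣ 24 * i := by
      have : (p : ℤ) ∣ 24 * i := by
        have hsub := dvd_sub h (Dvd.intro (24 * n + 7 : ℤ) rfl)
        rwa [show (24 * (p * n + i) + 7 * p - p * (24 * n + 7) : ℤ) = 24 * i by ring] at hsub
      exact_mod_cast this
    rw [show 24 * i = 2 ^ 3 * (3 * i) by ring] at h'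
    rcases hpp.dvd_mul.1 h' with h | h
    · have := Nat.le_of_dvd two_pos (hpp.dvd_of_dvd_pow h)
      omega
    · rcases hpp.dvd_mul.1 h with h | h <;> have := Nat.le_of_dvd (by omega) h <;> omega
  refine BraceletPartition.two_mul_sq_add_five_mul_sq_ne hp5 hleg hc t (6 * k - 1) (6 * l - 1) ?_
  rw [← BraceletPartition.twentyFour_mul_pentagonal_add_one,
    ← BraceletPartition.twentyFour_mul_pentagonal_add_one]
  zify at hkl hpr
  rw [pow_succ' _ (2 * t + 1)] at hkl
  linear_combination 24 * hkl - 7 * hpr
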